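/- Let $X$ be a complete Hausdorff locally convex space over $\mathbb T\in\{\mathbb R,\mathbb C\}$ whose topology is generated by semi-norms $\|\cdot\|_\alpha$, $\alpha\in\Omega$, and let $\mathcal L(X)$ be the space of continuous linear operators on $X$ with the strong operator topology. **Definitions.** A set $B\subset\mathcal L(X)$ is equicontinuous if for each $\alpha\in\Omega$ there are finitely many $\alpha_i\in\Omega$ and $b_i>0$ with $\sup_{G\in B}\|Gx\|_\alpha\le\sum_i b_i\|x\|_{\alpha_i}$ for all $x\in X$. Let $\mathcal E_X$ be the set of all $F:[0,\infty)\to\mathcal L(X)$ such that $F(0)=I$ and, for each $s\ge 0$, the set $\{F(d/n)^m : n,m\in\mathbb N,\ d\ge 0,\ md/n\le s\}$ is equicontinuous. For $F:[0,\infty)\to\mathcal L(X)$ and $f\in X$ let $F'_{mef}(0)f$ be the set of all $g\in X$ for which there is a family $(f_h)_{h\ge0}$ in $X$ with $f_h\to f$ and $h^{-1}(F(h)-F(0))f_h\to g$ as $h\to0^+$; let $D(F'_{mef}(0))=\{f: F'_{mef}(0)f\ne\emptyset\}$. Let $\mathcal F_X$ be the set of $F\in\mathcal E_X$ for which $D(F'_{mef}(0))$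 is dense in $X$. For $F\in\mathcal F_X$ the map $F'_{mef}(0)$ is single-valued, and the effective derivative $F'_{ef}(0)$ is the linear operator with domain $D(F'_{mef}(0))$ and $F'_{ef}(0)f\in F'_{mef}(0)f$. An $lC_0$-semigroup is a strongly continuous $S\in\mathcal E_X$ with $S(0)=I$ and $S(a+b)=S(a)S(b)$ for all $a,b\ge0$; its generator is the operator $x\mapsto\lim_{h\to0^+}h^{-1}(S(h)x-x)$ defined for exactly those $x\in X$ for which the limit exists. For a closable operator $Z$ in $X$ and $l>0$, a local solution on $[0,l)$ of $f'=\overline Z f$, $f(0)=f_0$, is a function $f:[0,l)\to X$ with $f(0)=f_0$ such that, for every $s\in[0,l)$, $f(s)\in D(\overline Z)$ and $f$ is differentiable at $s$ (one-sidedly at $s=0$) with $f'(s)=\overline Z f(s)$. **Theorem.** Let $F\in\mathcal F_X$, and let $Z$ be a linear operator with $D(Z)\subset D(F'_{ef}(0))$ and $Zg=F'_{ef}(0)g$ for $g\in D(Z)$. (Any such $Z$ is closable; this is part of the claim.) Let $\mathfrak A\subset D(Z)$ be a linear subspace that is dense in $X$, and suppose there is a fixed $l>0$ such that for every $f_0\in\mathfrak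 A$ there is a local solution on $[0,l)$ of $f'=\overline Z f$, $f(0)=f_0$. Then $Z$ is closable, its closure $\overline Z$ is the generator of an $lC_0$-semigroup $S$, and $$S(t)g=\lim_{n\to\infty}F(t/n)^n g\qquad\text{for all } t\ge0,\ g\in X.$$ -/

import Mathlib

open Filter Topology
open scoped NNReal

namespace Chernoff

section Equicontinuity

variable {𝕜 X Ω : Type*} [RCLike 𝕜] [AddCommGroup X] [Module 𝕜 X] [TopologicalSpace X]

/-- Equicontinuity of a set `B` of continuous linear operators, with respect to the semi-norms
`p α`, `α ∈ Ω`, that generate the topology: for every `α` there are finitely many indices `i ∈ s`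
and constants `b i > 0` with `sup_{G ∈ B} p α (G x) ≤ ∑ i ∈ s, b i * p i x` for all `x`. -/
def EquicontinuousSet (p : SeminormFamily 𝕜 X Ω) (B : Set (X →L[𝕜] X)) : Prop :=
  ∀ α : Ω, ∃ (s : Finset Ω) (b : Ω → ℝ), (∀ i ∈ s, 0 < b i) ∧
    ∀ G ∈ B, ∀ x : X, p α (G x) ≤ ∑ i ∈ s, b i * p i x

/-- The set `B_s^F = {F(d/n)^m | m d / n ≤ s, n, m ∈ {1, 2, ...}, d ≥ 0}`. -/
def powerSet (F : ℝ≥0 → X →L[𝕜] X) (s : ℝ≥0) : Set (X →L[𝕜] X) :=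
  {G | ∃ (n m : ℕ) (d : ℝ≥0), 1 ≤ n ∧ 1 ≤ m ∧ (m : ℝ≥0) * d / (n : ℝ≥0) ≤ s ∧
    G = F (d / (n : ℝ≥0)) ^ m}

/-- The class `𝓔_X`: `F(0) = I` and `B_s^F` is equicontinuous for each `s ≥ 0`. -/
structure ClassE (p : SeminormFamily 𝕜 X Ω) (F : ℝ≥0 → X →L[𝕜] X) : Prop where
  map_zero : F 0 = ContinuousLinearMap.id 𝕜 X
  equicontinuous : ∀ s : ℝ≥0, EquicontinuousSet p (powerSet F s)

end Equicontinuity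

section Derivatives

variable {𝕜 X Ω : Type*} [RCLike 𝕜] [AddCommGroup X] [Module 𝕜 X] [TopologicalSpace X]

/-- The value at `f` of the (strong) many-valued effective derivative of `F` at `0`: the set of
all `g` for which there is a family `φ h`, `h ≥ 0`, such that `φ h → f` and
`h⁻¹ (F(h) - F(0)) φ h → g` as `h → 0`. -/
def mefDeriv (F : ℝ≥0 → X →L[𝕜] X) (f : X) : Set X :=
  {g | ∃ φ : ℝ≥0 → X, Tendsto φ (𝓝[>] 0) (𝓝 f) ∧
    Tendsto (fun h : ℝ≥0 => (((h : ℝ) : 𝕜))⁻¹ • (F h (φ h) - F 0 (φ h))) (𝓝[>] 0) (𝓝 g)}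

/-- The domain of the many-valued effective derivative of `F` at `0`. -/
def mefDomain (F : ℝ≥0 → X →L[𝕜] X) : Set X :=
  {f | (mefDeriv F f).Nonempty}

/-- The class `𝓕_X`: functions of class `𝓔_X` whose many-valued effective derivative at `0` has
a dense domain. -/
structure ClassF (p : SeminormFamily 𝕜 X Ω) (F : ℝ≥0 → X →L[𝕜] X) : Prop where
  classE : ClassE p F
  dense : Dense (mefDomain F)

variable [IsTopologicalAddGroup X] [ContinuousSMul 𝕜 X]

/-- The graph `{(f, g) | g ∈ F'_mef(0) f}` of the many-valued effective derivative is a linear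
subspace of `X × X`. -/
def mefGraph (F : ℝ≥0 → X →L[𝕜] X) : Submodule 𝕜 (X × X) where
  carrier := {z | z.2 ∈ mefDeriv F z.1}
  zero_mem' := ⟨fun _ => 0, tendsto_const_nhds, by simpa using tendsto_const_nhds⟩
  add_mem' := by
    rintro ⟨a, b⟩ ⟨c, d⟩ ⟨φ, h1, h2⟩ ⟨ψ, h3, h4⟩
    refine ⟨fun h => φ h + ψ h, h1.add h3, (h2.add h4).congr fun h => ?_⟩
    simp only [map_add, ← smul_add]
    congr 1
    abel
  smul_mem' := by
    rintro c ⟨a, b⟩ ⟨φ, h1, h2⟩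
    refine ⟨fun h => c • φ h, h1.const_smul c, (h2.const_smul c).congr fun h => ?_⟩
    simp only [map_smul, ← smul_sub]
    rw [smul_comm]

/-- The (strong) effective derivative `F'_ef(0)` of `F` at `0`: the linear operator with domain
`mefDomain F` whose graph is that of the many-valued effective derivative. (If the latter were not
single-valued, `F'_ef(0)` would not exist and this would be a junk value;
see `effDeriv_graph` and `mem_effDeriv_domain`.) -/
noncomputable def effDeriv (F : ℝ≥0 → X →L[𝕜] X) : X →ₗ.[𝕜] X :=
  (mefGraph F).toLinearPMap

theorem mem_effDeriv_domain (F : ℝ≥0 → X →L[𝕜] X) (f : X) :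
    f ∈ (effDeriv F).domain ↔ f ∈ mefDomain F := by
  constructor
  · rintro ⟨⟨a, b⟩, h, rfl⟩
    exact ⟨b, h⟩
  · rintro ⟨g, hg⟩
    exact ⟨(f, g), hg, rfl⟩

/-- If the many-valued effective derivative is single-valued, its graph is the graph of
`effDeriv F`. -/
theorem effDeriv_graph (F : ℝ≥0 → X →L[𝕜] X)
    (hF : ∀ f ∈ mefDomain F, ∃! g, g ∈ mefDeriv F f) (f g : X) :
    (f, g) ∈ (effDeriv F).graph ↔ g ∈ mefDeriv F f := by
  have h : (effDeriv F).graph = mefGraph F := by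
    refine Submodule.toLinearPMap_graph_eq _ ?_
    rintro ⟨a, b⟩ hab ha
    obtain rfl : a = 0 := ha
    exact (hF 0 ⟨b, hab⟩).unique hab (mefGraph F).zero_mem
  rw [h]
  exact Iff.rfl

end Derivatives

section Semigroups

variable {𝕜 X Ω : Type*} [RCLike 𝕜] [AddCommGroup X] [Module 𝕜 X] [TopologicalSpace X]

/-- `lC₀`-semigroups. Continuity is meant for the strong operator topology. -/
structure IsLC0Semigroup (p : SeminormFamily 𝕜 X Ω) (T : ℝ≥0 → X →L[𝕜] X) : Prop where
  map_zero : T 0 = ContinuousLinearMap.id 𝕜 X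
  map_add : ∀ l m : ℝ≥0, T (l + m) = (T l).comp (T m)
  continuous : ∀ x : X, Continuous fun t : ℝ≥0 => T t x
  classE : ClassE p T

/-- `A` is the (strong) derivative `T'(0)` of `T` at `0`: `x` is in the domain of `A` and
`A x = y` if and only if `h⁻¹ (T(h) x - T(0) x) → y` as `h → 0`. -/
def IsStrongDeriv (T : ℝ≥0 → X →L[𝕜] X) (A : X →ₗ.[𝕜] X) : Prop :=
  ∀ x y : X, (x, y) ∈ A.graph ↔
    Tendsto (fun h : ℝ≥0 => (((h : ℝ) : 𝕜))⁻¹ • (T h x - T 0 x)) (𝓝[>] 0) (𝓝 y)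

/-- `A` is the generator of the `lC₀`-semigroup `T`. -/
structure IsGenerator (p : SeminormFamily 𝕜 X Ω) (A : X →ₗ.[𝕜] X) (T : ℝ≥0 → X →L[𝕜] X) :
    Prop where
  semigroup : IsLC0Semigroup p T
  deriv : IsStrongDeriv T A

/-- `f` is a solution on `[0, l)` of `f'(s) = A f(s)`, `f(0) = f₀`: for each `s ∈ [0, l)` the
value `f s` is in the domain of `A` and the difference quotients of `f` at `s`, taken inside
`[0, l)`, converge to `A (f s)`. Only the restriction of `f` to `[0, l)` matters. -/
def IsLocalSolution (A : X →ₗ.[𝕜] X) (l : ℝ) (f₀ : X) (f : ℝ → X) : Prop :=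
  f 0 = f₀ ∧ ∀ s ∈ Set.Ico 0 l, ∃ hs : f s ∈ A.domain,
    Tendsto (fun u : ℝ => (((u - s : ℝ) : 𝕜))⁻¹ • (f u - f s))
      (𝓝[Set.Ico 0 l \ {s}] s) (𝓝 (A ⟨f s, hs⟩))

end Semigroups

end Chernoff

/-!
The proof compares the discrete evolutions `F(h)^k` directly with the local solutions, without
resolvents: the semigroup may grow faster than exponentially, so its Laplace transform need not
exist. Integrals are replaced by finite sums throughout.

If `g` is an effective derivative of `F` at `f`, telescoping gives the discrete integral equation
`F(h)^k f ≈ f + h ∑_{j < k} F(h)^j g`, uniformly for bounded `k h`. By equicontinuity it persists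
for `(f, g)` in the closure of the graph of the effective derivative
(`eventually_seminorm_defect_le`), and together with strong continuity at `0` it yields
`F(h)^k f = f + k h g + o(k h)` up to errors that vanish as `h → 0`
(`exists_eventually_seminorm_taylor_le`). Taking `f = 0` shows `g = 0`, so that every restriction
`Z` of the effective derivative is closable.

Let `f` be a local solution and `t < l`. Modulo families that vanish as `h → 0`, the curve
`s ↦ F(h)^⌊(t - s) / h⌋ f(s)` on `[0, t]` is continuous and has right derivative zero by the
expansion, so it is constant (`eventually_seminorm_sub_le_of_deriv_zero`), which says that
`F(h)^⌊t / h⌋ f(0) → f(t)` (`tendsto_pow_steps_of_solution`). Density, equicontinuity and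
completeness extend the convergence to all vectors, and composition extends it to all times
(`exists_tendsto_pow_steps`). The limit `S` is a semigroup whose generator extends the closure of
`Z`. Conversely, for `a ∈ 𝔄` and `s < l` the vector `S(s) a` is the value of a local solution, hence
lies in the domain of the closure of `Z`; Riemann sums for `δ⁻¹ ∫₀^δ S(s) a ds` with `a → x` and
`δ → 0` approximate any `x` in the domain of the generator in the graph topology
(`mem_of_tendsto_diffQuot`), so that the two operators agree.
-/

namespace Chernoff

section Defect

/-! ### Continuous seminorms and local equicontinuity -/

theorem seminorm_smul_sum_le {𝕜 X : Type*} [RCLike 𝕜] [AddCommGroup X] [Module 𝕜 X]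
    (q : Seminorm 𝕜 X) (h : ℝ≥0) (k : ℕ) (v : ℕ → X) (c : ℝ)
    (hv : ∀ j < k, q (v j) ≤ c) :
    q (((h : ℝ) : 𝕜) • ∑ j ∈ Finset.range k, v j) ≤ (k : ℝ) * h * c := by
  rw [map_smul_eq_mul, RCLike.norm_ofReal, NNReal.abs_eq]
  have h1 : q (∑ j ∈ Finset.range k, v j) ≤ ∑ j ∈ Finset.range k, q (v j) :=
    Finset.le_sum_of_subadditive q (map_zero q).le (map_add_le_add q) _ _
  have h2 : ∑ j ∈ Finset.range k, q (v j) ≤ (Finset.range k).card • c :=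
    Finset.sum_le_card_nsmul _ _ _ fun j hj => hv j (Finset.mem_range.1 hj)
  rw [Finset.card_range, nsmul_eq_mul] at h2
  calc (h : ℝ) * q (∑ j ∈ Finset.range k, v j) ≤ h * (k * c) := by
        gcongr
        exact h1.trans h2
    _ = k * h * c := by ring

variable {𝕜 X Ω : Type*} [RCLike 𝕜] [AddCommGroup X] [Module 𝕜 X] [TopologicalSpace X]

/-- The powers `F(h)^k` with `k h ≤ T` are equicontinuous for every `T`. Equicontinuity is
expressed through arbitrary continuous seminorms, which avoids the finite sums over the index set
of a generating family. -/
def LocallyEquicontinuous (F : ℝ≥0 → X →L[𝕜] X) : Prop :=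
  ∀ q : Seminorm 𝕜 X, Continuous q → ∀ T : ℝ, ∃ Q : Seminorm 𝕜 X, Continuous Q ∧
    ∀ (h : ℝ≥0) (k : ℕ), (k : ℝ) * h ≤ T → ∀ x : X, q ((F h ^ k) x) ≤ Q x

theorem exists_seminorm_eq_sum {ι : Type*} (P : ι → Seminorm 𝕜 X) (s : Finset ι)
    (hP : ∀ i ∈ s, Continuous (P i)) :
    ∃ Q : Seminorm 𝕜 X, Continuous Q ∧ ∀ x, Q x = ∑ i ∈ s, P i x := by
  classical
  induction s using Finset.induction_on with
  | empty => exact ⟨0, continuous_const, fun x => by simp⟩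
  | insert a s ha ih =>
    obtain ⟨Q, hQ, hQs⟩ := ih fun i hi => hP i (Finset.mem_insert_of_mem hi)
    refine ⟨P a + Q, (hP a (Finset.mem_insert_self a s)).add hQ, fun x => ?_⟩
    rw [Finset.sum_insert ha, ← hQs]
    rfl

theorem pow_eq_of_map_add {S : ℝ≥0 → X →L[𝕜] X} (hS0 : S 0 = ContinuousLinearMap.id 𝕜 X)
    (hadd : ∀ a b, S (a + b) = (S a).comp (S b)) (a : ℝ≥0) (k : ℕ) : S a ^ k = S (k * a) := by
  induction k with
  | zero => simp [hS0]; rfl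
  | succ k ih =>
    rw [pow_succ, ih]
    push_cast
    rw [add_mul, one_mul, hadd]
    rfl

theorem EquicontinuousSet.exists_seminorm [IsTopologicalAddGroup X] [ContinuousSMul 𝕜 X]
    {p : SeminormFamily 𝕜 X Ω} (hp : WithSeminorms p)
    {B : Set (X →L[𝕜] X)} (hB : EquicontinuousSet p B) {q : Seminorm 𝕜 X} (hq : Continuous q) :
    ∃ Q : Seminorm 𝕜 X, Continuous Q ∧ ∀ G ∈ B, ∀ x, q (G x) ≤ Q x := by
  have h1 : ∀ i, ∃ Q : Seminorm 𝕜 X, Continuous Q ∧ ∀ G ∈ B, ∀ x, p i (G x) ≤ Q x := by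
    intro i
    obtain ⟨s, b, hb, h⟩ := hB i
    obtain ⟨Q, hQ, hQs⟩ := exists_seminorm_eq_sum (fun j => (b j).toNNReal • p j) s
      fun j _ => (hp.continuous_seminorm j).const_smul (b j).toNNReal
    refine ⟨Q, hQ, fun G hG x => (h G hG x).trans_eq ?_⟩
    rw [hQs]
    refine Finset.sum_congr rfl fun j hj => ?_
    simp [NNReal.smul_def, (hb j hj).le]
  choose P hP hPB using h1
  obtain ⟨s, C, -, hC⟩ := Seminorm.bound_of_continuous hp q hq
  obtain ⟨Q, hQ, hQs⟩ := exists_seminorm_eq_sum P s fun i _ => hP i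
  refine ⟨C • Q, hQ.const_smul C, fun G hG x => (hC _).trans ?_⟩
  simp only [smul_apply, NNReal.smul_def, smul_eq_mul]
  gcongr
  rw [hQs]
  refine Seminorm.finset_sup_apply_le (Finset.sum_nonneg fun i _ => apply_nonneg _ _) fun i hi => ?_
  exact (hPB i G hG x).trans
    (Finset.single_le_sum (f := fun i => P i x) (fun i _ => apply_nonneg _ _) hi)

theorem pow_mem_powerSet {F : ℝ≥0 → X →L[𝕜] X} (hF0 : F 0 = ContinuousLinearMap.id 𝕜 X)
    {h T : ℝ≥0} {k : ℕ} (hk : (k : ℝ) * h ≤ T) : F h ^ k ∈ powerSet F T := by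
  have hT : (k : ℝ≥0) * h ≤ T := by
    rw [← NNReal.coe_le_coe]
    push_cast
    exact hk
  rcases Nat.eq_zero_or_pos k with rfl | hk0
  -- `powerSet` only contains positive powers, but `F(h)^0 = F(0)^1`.
  · exact ⟨1, 1, 0, le_rfl, le_rfl, by simp, by simp [hF0]; rfl⟩
  · exact ⟨1, k, h, le_rfl, hk0, by simpa using hT, by simp⟩

theorem ClassE.locallyEquicontinuous [IsTopologicalAddGroup X] [ContinuousSMul 𝕜 X]
    {p : SeminormFamily 𝕜 X Ω} (hp : WithSeminorms p)
    {F : ℝ≥0 → X →L[𝕜] X} (hF : ClassE p F) : LocallyEquicontinuous F := by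
  intro q hq T
  obtain ⟨Q, hQ, hB⟩ := (hF.equicontinuous T.toNNReal).exists_seminorm hp hq
  exact ⟨Q, hQ, fun h k hk x =>
    hB _ (pow_mem_powerSet hF.map_zero (hk.trans (Real.le_coe_toNNReal T))) x⟩

theorem eventually_seminorm_sub_lt [IsTopologicalAddGroup X] {ι : Type*} {L : Filter ι}
    {u : ι → X} {y : X} (hu : Tendsto u L (𝓝 y))
    {q : Seminorm 𝕜 X} (hq : Continuous q) {ε : ℝ} (hε : 0 < ε) : ∀ᶠ i in L, q (u i - y) < ε := by
  have h : Tendsto (fun i => q (u i - y)) L (𝓝 (q (y - y))) :=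
    (hq.tendsto _).comp (hu.sub tendsto_const_nhds)
  rw [sub_self, map_zero] at h
  exact h.eventually_lt_const hε

theorem exists_mem_seminorm_lt_of_mem_closure [IsTopologicalAddGroup X] {G : Set (X × X)}
    {x y : X} (hxy : (x, y) ∈ closure G)
    {q : Seminorm 𝕜 X} (hq : Continuous q) {ε : ℝ} (hε : 0 < ε) :
    ∃ z ∈ G, q (x - z.1) < ε ∧ q (y - z.2) < ε := by
  have h1 : ∀ᶠ z : X × X in 𝓝 (x, y), q (z.1 - x) < ε ∧ q (z.2 - y) < ε :=
    (eventually_seminorm_sub_lt (continuous_fst.tendsto (x, y)) hq hε).and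
      (eventually_seminorm_sub_lt (continuous_snd.tendsto (x, y)) hq hε)
  obtain ⟨z, ⟨h1, h2⟩, hz⟩ := mem_closure_iff_nhds.1 hxy _ h1
  exact ⟨z, hz, by rwa [map_sub_rev], by rwa [map_sub_rev]⟩

theorem exists_mem_seminorm_lt_of_dense [IsTopologicalAddGroup X] {G : Set X} (hG : Dense G)
    (x : X) {q : Seminorm 𝕜 X} (hq : Continuous q) {ε : ℝ} (hε : 0 < ε) :
    ∃ z ∈ G, q (x - z) < ε := by
  obtain ⟨z, h1, hz⟩ := mem_closure_iff_nhds.1 (hG x) _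
    (eventually_seminorm_sub_lt (continuous_id.tendsto x) hq hε)
  exact ⟨z, hz, by rw [map_sub_rev]; exact h1⟩

theorem mem_closure_of_forall_seminorm {p : SeminormFamily 𝕜 X Ω} (hp : WithSeminorms p)
    {G : Set (X × X)} {x y : X}
    (h : ∀ q : Seminorm 𝕜 X, Continuous q → ∀ ε > 0, ∃ z ∈ G, q (z.1 - x) ≤ ε ∧ q (z.2 - y) ≤ ε) :
    (x, y) ∈ closure G := by
  classical
  rw [mem_closure_iff_nhds]
  intro U hU
  obtain ⟨V, hV, W, hW, hVW⟩ := mem_nhds_prod_iff.1 hU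
  obtain ⟨s, r, hr, hs⟩ := (hp.mem_nhds_iff _ _).1 hV
  obtain ⟨s', r', hr', hs'⟩ := (hp.mem_nhds_iff _ _).1 hW
  have hm : 0 < min r r' := lt_min hr hr'
  obtain ⟨Q, hQ, hQs⟩ := exists_seminorm_eq_sum p (s ∪ s') fun i _ => hp.continuous_seminorm i
  have key : ∀ t ⊆ s ∪ s', ∀ v, t.sup p v ≤ Q v := by
    intro t ht v
    rw [hQs]
    refine Seminorm.finset_sup_apply_le (Finset.sum_nonneg fun i _ => apply_nonneg _ _)
      fun i hi => ?_
    exact Finset.single_le_sum (f := fun i => p i v) (fun i _ => apply_nonneg _ _) (ht hi)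
  obtain ⟨z, hz, h1, h2⟩ := h Q hQ (min r r' / 2) (by positivity)
  refine ⟨z, hVW ⟨hs ?_, hs' ?_⟩, hz⟩
  · rw [Seminorm.mem_ball]
    have := key s Finset.subset_union_left (z.1 - x)
    have := min_le_left r r'
    linarith
  · rw [Seminorm.mem_ball]
    have := key s' Finset.subset_union_right (z.2 - y)
    have := min_le_right r r'
    linarith

theorem eq_of_forall_seminorm [T2Space X] {p : SeminormFamily 𝕜 X Ω} (hp : WithSeminorms p)
    {x y : X} (h : ∀ q : Seminorm 𝕜 X, Continuous q → ∀ ε > 0, q (x - y) ≤ ε) : x = y := by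
  have h1 : Tendsto (fun _ : ℕ => x) atTop (𝓝 y) :=
    (hp.tendsto_nhds _ _).2 fun i ε hε => Eventually.of_forall fun _ =>
      (h (p i) (hp.continuous_seminorm i) (ε / 2) (by positivity)).trans_lt (by linarith)
  exact tendsto_nhds_unique tendsto_const_nhds h1

/-! ### The discrete integral equation -/

/-- The defect `F(h)^k f - f - h ∑_{j < k} F(h)^j g`, a discrete version of
`S(t) f - f - ∫₀ᵗ S(s) g ds`. -/
noncomputable def defect (F : ℝ≥0 → X →L[𝕜] X) (h : ℝ≥0) (k : ℕ) (f g : X) : X :=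
  (F h ^ k) f - f - ((h : ℝ) : 𝕜) • ∑ j ∈ Finset.range k, (F h ^ j) g

theorem cast_mul_le_of_le {h : ℝ≥0} {j k : ℕ} {T : ℝ} (hj : j ≤ k) (hk : (k : ℝ) * h ≤ T) :
    (j : ℝ) * h ≤ T :=
  (mul_le_mul_of_nonneg_right (Nat.cast_le.2 hj) h.2).trans hk

theorem defect_sub (F : ℝ≥0 → X →L[𝕜] X) (h : ℝ≥0) (k : ℕ) (f g a b : X) :
    defect F h k f g - defect F h k a b = defect F h k (f - a) (g - b) := by
  simp only [defect, map_sub, Finset.sum_sub_distrib, smul_sub]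
  abel

theorem seminorm_defect_le {F : ℝ≥0 → X →L[𝕜] X} {q Q : Seminorm 𝕜 X} {T : ℝ} (hT : 0 ≤ T)
    (hQ : ∀ (h : ℝ≥0) (k : ℕ), (k : ℝ) * h ≤ T → ∀ x : X, q ((F h ^ k) x) ≤ Q x)
    {h : ℝ≥0} {k : ℕ} (hk : (k : ℝ) * h ≤ T) (f g : X) :
    q (defect F h k f g) ≤ 2 * Q f + T * Q g := by
  have h1 := hQ h k hk f
  have h2 : q f ≤ Q f := by simpa using hQ h 0 (by simpa using hT) f
  have h3 : q (((h : ℝ) : 𝕜) • ∑ j ∈ Finset.range k, (F h ^ j) g) ≤ (k : ℝ) * h * Q g :=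
    seminorm_smul_sum_le q h k _ _ fun j hj => hQ h j (cast_mul_le_of_le hj.le hk) g
  have h4 : (k : ℝ) * h * Q g ≤ T * Q g := mul_le_mul_of_nonneg_right hk (apply_nonneg _ _)
  have h5 := map_sub_le_add q ((F h ^ k) f - f) (((h : ℝ) : 𝕜) • ∑ j ∈ Finset.range k, (F h ^ j) g)
  have h6 := map_sub_le_add q ((F h ^ k) f) f
  unfold defect
  linarith

/-- Telescoping: the defect vanishes if `g` is the exact difference quotient of `F` at `f`. -/
theorem defect_eq_zero {F : ℝ≥0 → X →L[𝕜] X} (hF0 : F 0 = ContinuousLinearMap.id 𝕜 X)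
    {h : ℝ≥0} (hh : 0 < h) (k : ℕ) (f : X) :
    defect F h k f ((((h : ℝ) : 𝕜))⁻¹ • (F h f - F 0 f)) = 0 := by
  have hne : ((h : ℝ) : 𝕜) ≠ 0 := by exact_mod_cast hh.ne'
  have : ∀ j, (F h ^ j) (F h f - F 0 f) = (F h ^ (j + 1)) f - (F h ^ j) f := by
    intro j
    rw [map_sub, hF0, pow_succ]
    rfl
  simp only [defect, map_smul, ← Finset.smul_sum, smul_inv_smul₀ hne, this]
  rw [Finset.sum_range_sub (fun j => (F h ^ j) f)]
  simp

variable [IsTopologicalAddGroup X] [ContinuousSMul 𝕜 X]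

theorem eventually_seminorm_defect_le_of_mem_mefGraph {F : ℝ≥0 → X →L[𝕜] X}
    (hF0 : F 0 = ContinuousLinearMap.id 𝕜 X) (hF : LocallyEquicontinuous F) {f g : X}
    (hfg : (f, g) ∈ mefGraph F) {q : Seminorm 𝕜 X} (hq : Continuous q) {T : ℝ} (hT : 0 ≤ T)
    {ε : ℝ} (hε : 0 < ε) :
    ∀ᶠ h : ℝ≥0 in 𝓝[>] 0, ∀ k : ℕ, (k : ℝ) * h ≤ T → q (defect F h k f g) ≤ ε := by
  obtain ⟨φ, hφ, hψ⟩ := hfg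
  obtain ⟨Q, hQc, hQ⟩ := hF q hq T
  have hδ : 0 < ε / (2 + T) := by positivity
  filter_upwards [eventually_seminorm_sub_lt hφ hQc hδ, eventually_seminorm_sub_lt hψ hQc hδ,
    self_mem_nhdsWithin] with h h1 h2 hh k hk
  have h3 := seminorm_defect_le hT hQ hk (φ h - f)
    ((((h : ℝ) : 𝕜))⁻¹ • (F h (φ h) - F 0 (φ h)) - g)
  rw [← defect_sub, defect_eq_zero hF0 hh, zero_sub, map_neg_eq_map] at h3
  refine h3.trans ?_
  calc _ ≤ 2 * (ε / (2 + T)) + T * (ε / (2 + T)) := by gcongr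
    _ = ε := by field_simp

/-- The graph of the effective derivative need not be closed when the topology is not metrizable,
but the discrete integral equation survives passage to its closure. -/
theorem eventually_seminorm_defect_le {F : ℝ≥0 → X →L[𝕜] X}
    (hF0 : F 0 = ContinuousLinearMap.id 𝕜 X) (hF : LocallyEquicontinuous F) {f g : X}
    (hfg : (f, g) ∈ closure (mefGraph F : Set (X × X)))
    {q : Seminorm 𝕜 X} (hq : Continuous q) {T : ℝ} (hT : 0 ≤ T) {ε : ℝ} (hε : 0 < ε) :
    ∀ᶠ h : ℝ≥0 in 𝓝[>] 0, ∀ k : ℕ, (k : ℝ) * h ≤ T → q (defect F h k f g) ≤ ε := by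
  obtain ⟨Q, hQc, hQ⟩ := hF q hq T
  have hδ : 0 < ε / 2 / (2 + T) := by positivity
  obtain ⟨⟨a, b⟩, hab, ha, hb⟩ := exists_mem_seminorm_lt_of_mem_closure hfg hQc hδ
  filter_upwards [eventually_seminorm_defect_le_of_mem_mefGraph hF0 hF hab hq hT (half_pos hε)]
    with h h1 k hk
  have h2 := seminorm_defect_le hT hQ hk (f - a) (g - b)
  rw [← defect_sub] at h2
  have h3 : 2 * Q (f - a) + T * Q (g - b) ≤ ε / 2 :=
    calc _ ≤ 2 * (ε / 2 / (2 + T)) + T * (ε / 2 / (2 + T)) := by gcongr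
      _ = ε / 2 := by field_simp
  have h4 := map_add_le_add q (defect F h k f g - defect F h k a b) (defect F h k a b)
  rw [sub_add_cancel] at h4
  have := h1 k hk
  linarith

/-- Strong continuity at `0` of the discrete evolution, uniformly in the step size. -/
theorem exists_eventually_seminorm_pow_sub_le {F : ℝ≥0 → X →L[𝕜] X}
    (hF0 : F 0 = ContinuousLinearMap.id 𝕜 X) (hF : LocallyEquicontinuous F)
    (hd : Dense (mefDomain F)) (x : X) {q : Seminorm 𝕜 X} (hq : Continuous q)
    {ε : ℝ} (hε : 0 < ε) :
    ∃ δ > 0, ∀ᶠ h : ℝ≥0 in 𝓝[>] 0, ∀ k : ℕ, (k : ℝ) * h ≤ δ → q ((F h ^ k) x - x) ≤ ε := by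
  obtain ⟨Q, hQc, hQ⟩ := hF q hq 1
  obtain ⟨f, ⟨g, hfg⟩, hf⟩ := exists_mem_seminorm_lt_of_dense hd x hQc (ε := ε / 8) (by positivity)
  have hQg : 0 ≤ Q g := apply_nonneg _ _
  refine ⟨min 1 (ε / 4 / (1 + Q g)), lt_min one_pos (by positivity), ?_⟩
  filter_upwards [eventually_seminorm_defect_le_of_mem_mefGraph hF0 hF (f := f) (g := g) hfg hq
    zero_le_one (ε := ε / 4) (by positivity)] with h h1 k hk
  have hk1 := hk.trans (min_le_left _ _)
  have hk2 := hk.trans (min_le_right _ _)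
  have e : (F h ^ k) x - x = (F h ^ k) (x - f) - (x - f) + defect F h k f g
      + ((h : ℝ) : 𝕜) • ∑ j ∈ Finset.range k, (F h ^ j) g := by
    simp only [defect, map_sub]
    abel
  have h2 := hQ h k hk1 (x - f)
  have h3 : q (x - f) ≤ Q (x - f) := by simpa using hQ h 0 (by simp) (x - f)
  have h4 : q (((h : ℝ) : 𝕜) • ∑ j ∈ Finset.range k, (F h ^ j) g) ≤ (k : ℝ) * h * Q g :=
    seminorm_smul_sum_le q h k _ _ fun j hj => hQ h j (cast_mul_le_of_le hj.le hk1) g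
  have h5 : (k : ℝ) * h * Q g ≤ ε / 4 :=
    calc (k : ℝ) * h * Q g ≤ ε / 4 / (1 + Q g) * (1 + Q g) := by
          gcongr
          linarith
      _ = ε / 4 := by field_simp
  have h6 := h1 k hk1
  have h7 := map_sub_le_add q ((F h ^ k) (x - f)) (x - f)
  rw [e]
  refine (map_add_le_add q _ _).trans ?_
  have h8 := map_add_le_add q ((F h ^ k) (x - f) - (x - f)) (defect F h k f g)
  linarith

/-- First-order Taylor expansion of the discrete evolution, uniformly in the step size. -/
theorem exists_eventually_seminorm_taylor_le {F : ℝ≥0 → X →L[𝕜] X}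
    (hF0 : F 0 = ContinuousLinearMap.id 𝕜 X) (hF : LocallyEquicontinuous F)
    (hd : Dense (mefDomain F)) {f g : X} (hfg : (f, g) ∈ closure (mefGraph F : Set (X × X)))
    {q : Seminorm 𝕜 X} (hq : Continuous q) {ε : ℝ} (hε : 0 < ε) :
    ∃ δ > 0, ∀ η > 0, ∀ᶠ h : ℝ≥0 in 𝓝[>] 0, ∀ k : ℕ, (k : ℝ) * h ≤ δ →
      q ((F h ^ k) f - f - ((k * h : ℝ) : 𝕜) • g) ≤ ε * (k * h) + η := by
  obtain ⟨δ, hδ, h1⟩ := exists_eventually_seminorm_pow_sub_le hF0 hF hd g hq hε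
  refine ⟨δ, hδ, fun η hη => ?_⟩
  filter_upwards [h1, eventually_seminorm_defect_le hF0 hF hfg hq hδ.le hη] with h h1 h2 k hk
  have e : (F h ^ k) f - f - ((k * h : ℝ) : 𝕜) • g = defect F h k f g
      + ((h : ℝ) : 𝕜) • ∑ j ∈ Finset.range k, ((F h ^ j) g - g) := by
    simp only [defect, Finset.sum_sub_distrib, Finset.sum_const, Finset.card_range, smul_sub]
    rw [← Nat.cast_smul_eq_nsmul 𝕜, smul_smul]
    push_cast
    rw [mul_comm (k : 𝕜)]
    abel
  have h4 : q (((h : ℝ) : 𝕜) • ∑ j ∈ Finset.range k, ((F h ^ j) g - g)) ≤ (k : ℝ) * h * ε :=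
    seminorm_smul_sum_le q h k _ _ fun j hj => h1 j (cast_mul_le_of_le hj.le hk)
  have h5 := h2 k hk
  rw [e]
  refine (map_add_le_add q _ _).trans ?_
  linarith

end Defect

section Solutions

/-! ### Counting steps -/

/-- The number `⌊t / h⌋` of steps of size `h` that fit into `[0, t]`. -/
noncomputable def steps (t : ℝ) (h : ℝ≥0) : ℕ := ⌊t / (h : ℝ)⌋₊

theorem steps_zero (h : ℝ≥0) : steps 0 h = 0 := by simp [steps]

theorem steps_mul_le {t : ℝ} (ht : 0 ≤ t) (h : ℝ≥0) : (steps t h : ℝ) * h ≤ t := by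
  rcases eq_or_ne h 0 with rfl | hh
  · simpa using ht
  · have hh' : (0 : ℝ) < h := NNReal.coe_pos.2 (pos_iff_ne_zero.2 hh)
    exact (le_div_iff₀ hh').1 (Nat.floor_le (by positivity))

theorem lt_steps_mul (t : ℝ) {h : ℝ≥0} (hh : 0 < h) : t < (steps t h : ℝ) * h + h := by
  have hh' : (0 : ℝ) < h := NNReal.coe_pos.2 hh
  have := (div_lt_iff₀ hh').1 (Nat.lt_floor_add_one (t / (h : ℝ)))
  unfold steps
  linarith

theorem steps_mono {s t : ℝ} (hst : s ≤ t) (h : ℝ≥0) : steps s h ≤ steps t h :=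
  Nat.floor_mono (div_le_div_of_nonneg_right hst h.2)

theorem steps_add_le {a b : ℝ} (ha : 0 ≤ a) (hb : 0 ≤ b) (h : ℝ≥0) :
    steps a h + steps b h ≤ steps (a + b) h := by
  refine Nat.le_floor ?_
  push_cast
  rw [add_div]
  exact add_le_add (Nat.floor_le (by positivity)) (Nat.floor_le (by positivity))

theorem steps_div_natCast {t : ℝ≥0} (ht : 0 < t) {n : ℕ} (hn : n ≠ 0) :
    steps t (t / (n : ℝ≥0)) = n := by
  have h1 : (t : ℝ) ≠ 0 := by exact_mod_cast ht.ne'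
  have h2 : (n : ℝ) ≠ 0 := by exact_mod_cast hn
  have : (t : ℝ) / ((t / (n : ℝ≥0) : ℝ≥0) : ℝ) = n := by
    push_cast
    field_simp
  rw [steps, this, Nat.floor_natCast]

theorem eventually_coe_lt {δ : ℝ} (hδ : 0 < δ) : ∀ᶠ h : ℝ≥0 in 𝓝[>] 0, (h : ℝ) < δ :=
  nhdsWithin_le_nhds ((NNReal.continuous_coe.tendsto 0).eventually_lt_const (by simpa using hδ))

/-- Splitting a run of length `t - s` at `s'`; the rounded length of the first part is within one
step of `s' - s`. -/
theorem pow_steps_eq {𝕜 X : Type*} [RCLike 𝕜] [AddCommGroup X] [Module 𝕜 X] [TopologicalSpace X]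
    (F : ℝ≥0 → X →L[𝕜] X) {h : ℝ≥0} (hh : 0 < h) {s s' t : ℝ} (hs : s ≤ s')
    (hst : s' ≤ t) : ∃ k : ℕ, (k : ℝ) * h ≤ s' - s + h ∧ s' - s - h ≤ (k : ℝ) * h ∧
      F h ^ steps (t - s) h = F h ^ steps (t - s') h * F h ^ k := by
  have hle : steps (t - s') h ≤ steps (t - s) h := steps_mono (by linarith) h
  refine ⟨steps (t - s) h - steps (t - s') h, ?_, ?_, ?_⟩
  · have h1 := steps_mul_le (t := t - s) (by linarith) h
    have h2 := lt_steps_mul (t - s') hh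
    rw [Nat.cast_sub hle]
    linarith
  · have h1 := steps_mul_le (t := t - s') (by linarith) h
    have h2 := lt_steps_mul (t - s) hh
    rw [Nat.cast_sub hle]
    linarith
  · rw [← pow_add, Nat.add_sub_cancel' hle]

/-! ### Functions with vanishing derivative modulo null families -/

/-- A version of "vanishing derivative implies constant" for a curve `u` of families
`u s : ι → X`, where families are measured by the limit superior of a seminorm along `L`. -/
theorem eventually_seminorm_sub_le_of_deriv_zero {𝕜 X ι : Type*} [RCLike 𝕜]
    [AddCommGroup X] [Module 𝕜 X] {L : Filter ι} (u : ℝ → ι → X)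
    (q : Seminorm 𝕜 X) {t : ℝ} (ht : 0 ≤ t)
    (hcont : ∀ s ∈ Set.Icc 0 t, ∀ ε > 0, ∀ᶠ s' in 𝓝[Set.Icc 0 t] s, ∀ᶠ i in L,
      q (u s' i - u s i) ≤ ε)
    (hder : ∀ s ∈ Set.Ico 0 t, ∀ ε > 0, ∀ᶠ s' in 𝓝[>] s, ∀ η > 0, ∀ᶠ i in L,
      q (u s' i - u s i) ≤ ε * (s' - s) + η) {η : ℝ} (hη : 0 < η) :
    ∀ᶠ i in L, q (u t i - u 0 i) ≤ η := by
  have main : ∀ ε > 0, t ∈ {s | ∀ η > 0, ∀ᶠ i in L, q (u s i - u 0 i) ≤ ε * s + η} := by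
    intro ε hε
    refine IsClosed.Icc_subset_of_forall_exists_gt (a := 0) (b := t) ?_ ?_ ?_ ⟨ht, le_rfl⟩
    · refine isClosed_of_closure_subset fun s hs => ?_
      have hsI : s ∈ Set.Icc 0 t :=
        isClosed_Icc.closure_subset_iff.2 Set.inter_subset_right hs
      refine ⟨fun η hη => ?_, hsI⟩
      have := mem_closure_iff_nhdsWithin_neBot.1 hs
      have h1 := (hcont s hsI (η / 3) (by positivity)).filter_mono
        (nhdsWithin_mono s (Set.inter_subset_right
          (s := {s | ∀ η > 0, ∀ᶠ i in L, q (u s i - u 0 i) ≤ ε * s + η})))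
      have h2 : ∀ᶠ s' in 𝓝 s, ε * s' < ε * s + η / 3 :=
        ((continuous_const.mul continuous_id).tendsto s).eventually_lt_const
          (lt_add_of_pos_right _ (by positivity))
      obtain ⟨s', h1, h2, h3⟩ :=
        (h1.and ((h2.filter_mono nhdsWithin_le_nhds).and self_mem_nhdsWithin)).exists
      filter_upwards [h1, h3.1 (η / 3) (by positivity)] with i h4 h5
      have h6 := map_sub_le_add q (u s' i - u 0 i) (u s' i - u s i)
      rw [sub_sub_sub_cancel_left] at h6
      linarith
    · intro η hη
      simp [hη.le]
    · rintro x ⟨hx, hxI⟩ y hy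
      obtain ⟨s', h1, h2⟩ := ((hder x hxI ε hε).and (Ioc_mem_nhdsGT hy)).exists
      refine ⟨s', fun η hη => ?_, h2⟩
      filter_upwards [h1 (η / 2) (by positivity), hx (η / 2) (by positivity)] with i h3 h4
      have h5 := map_add_le_add q (u s' i - u x i) (u x i - u 0 i)
      rw [sub_add_sub_cancel] at h5
      linarith
  filter_upwards [main (η / 2 / (1 + t)) (by positivity) (η / 2) (by positivity)] with i hi
  have : η / 2 / (1 + t) * t ≤ η / 2 :=
    calc η / 2 / (1 + t) * t ≤ η / 2 / (1 + t) * (1 + t) := by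
          gcongr
          linarith
      _ = η / 2 := by field_simp
  linarith

variable {𝕜 X Ω : Type*} [RCLike 𝕜] [AddCommGroup X] [Module 𝕜 X] [TopologicalSpace X]

variable [IsTopologicalAddGroup X] [ContinuousSMul 𝕜 X]

/-! ### Single-valuedness and closability -/

/-- The expansion at `f = 0` reads `k h g = o(k h)`, which forces `g = 0`. -/
theorem eq_zero_of_mem_closure_mefGraph [T2Space X] {p : SeminormFamily 𝕜 X Ω}
    (hp : WithSeminorms p) {F : ℝ≥0 → X →L[𝕜] X}
    (hF0 : F 0 = ContinuousLinearMap.id 𝕜 X) (hF : LocallyEquicontinuous F)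
    (hd : Dense (mefDomain F)) {g : X}
    (hg : ((0 : X), g) ∈ closure (mefGraph F : Set (X × X))) : g = 0 := by
  refine eq_of_forall_seminorm hp fun q hq ε hε => ?_
  obtain ⟨δ, hδ, h1⟩ := exists_eventually_seminorm_taylor_le hF0 hF hd hg hq (half_pos hε)
  obtain ⟨h, h2, h3, hh⟩ := ((h1 (ε / 2 * (δ / 2)) (by positivity)).and
    ((eventually_coe_lt (half_pos hδ)).and self_mem_nhdsWithin)).exists
  have h4 := h2 _ (steps_mul_le hδ.le h)
  have h5 := lt_steps_mul δ hh
  set r : ℝ := (steps δ h : ℝ) * h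
  have hr : δ / 2 < r := by linarith
  have hr0 : 0 < r := by linarith
  rw [map_zero, sub_zero, zero_sub, map_neg_eq_map, map_smul_eq_mul, RCLike.norm_ofReal,
    abs_of_pos hr0] at h4
  rw [sub_zero]
  have h6 : r * q g ≤ r * ε := by nlinarith
  exact le_of_mul_le_mul_left h6 hr0

theorem graph_effDeriv [T2Space X] {p : SeminormFamily 𝕜 X Ω}
    (hp : WithSeminorms p) {F : ℝ≥0 → X →L[𝕜] X}
    (hF0 : F 0 = ContinuousLinearMap.id 𝕜 X) (hF : LocallyEquicontinuous F)
    (hd : Dense (mefDomain F)) : (effDeriv F).graph = mefGraph F := by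
  refine Submodule.toLinearPMap_graph_eq _ ?_
  rintro ⟨a, b⟩ hab rfl
  exact eq_zero_of_mem_closure_mefGraph hp hF0 hF hd (subset_closure hab)

theorem closure_graph_subset [T2Space X] {p : SeminormFamily 𝕜 X Ω}
    (hp : WithSeminorms p) {F : ℝ≥0 → X →L[𝕜] X}
    (hF0 : F 0 = ContinuousLinearMap.id 𝕜 X) (hF : LocallyEquicontinuous F)
    (hd : Dense (mefDomain F)) {Z : X →ₗ.[𝕜] X} (hZ : Z ≤ effDeriv F) :
    closure (Z.graph : Set (X × X)) ⊆ closure (mefGraph F : Set (X × X)) := by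
  refine closure_mono fun z hz => ?_
  have := LinearPMap.le_graph_of_le hZ hz
  rwa [graph_effDeriv hp hF0 hF hd] at this

theorem isClosable_of_le_effDeriv [T2Space X] {p : SeminormFamily 𝕜 X Ω}
    (hp : WithSeminorms p) {F : ℝ≥0 → X →L[𝕜] X}
    (hF0 : F 0 = ContinuousLinearMap.id 𝕜 X) (hF : LocallyEquicontinuous F)
    (hd : Dense (mefDomain F)) {Z : X →ₗ.[𝕜] X} (hZ : Z ≤ effDeriv F) : Z.IsClosable := by
  refine ⟨Z.graph.topologicalClosure.toLinearPMap, (Submodule.toLinearPMap_graph_eq _ ?_).symm⟩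
  rintro ⟨a, b⟩ hab rfl
  exact eq_zero_of_mem_closure_mefGraph hp hF0 hF hd (closure_graph_subset hp hF0 hF hd hZ hab)

/-! ### Convergence along local solutions -/

/-- The curve `s ↦ F(h)^⌊(t - s) / h⌋ f(s)` joins `F(h)^⌊t / h⌋ f(0)` to `f(t)`, and its derivative
vanishes in the limit `h → 0`, because `f' = g` while `F(h)^k f ≈ f + k h g`. -/
theorem tendsto_pow_steps_of_solution {p : SeminormFamily 𝕜 X Ω}
    (hp : WithSeminorms p) {F : ℝ≥0 → X →L[𝕜] X}
    (hF0 : F 0 = ContinuousLinearMap.id 𝕜 X) (hF : LocallyEquicontinuous F)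
    (hd : Dense (mefDomain F)) {f : ℝ → X} {l : ℝ}
    (hf : ∀ s ∈ Set.Ico 0 l, ∃ g, (f s, g) ∈ closure (mefGraph F : Set (X × X)) ∧
      Tendsto (fun u : ℝ => (((u - s : ℝ) : 𝕜))⁻¹ • (f u - f s))
        (𝓝[Set.Ico 0 l \ {s}] s) (𝓝 g))
    {t : ℝ} (ht : 0 ≤ t) (htl : t < l) :
    Tendsto (fun h : ℝ≥0 => (F h ^ steps t h) (f 0)) (𝓝[>] 0) (𝓝 (f t)) := by
  refine (hp.tendsto_nhds _ _).2 fun i ε₀ hε₀ => ?_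
  have hq := hp.continuous_seminorm i
  set q := p i
  obtain ⟨Q, hQc, hQ⟩ := hF q hq t
  obtain ⟨Q', hQc', hQ'⟩ := hF Q hQc (t + 1)
  have hstep : ∀ (h : ℝ≥0), 0 < h → ∀ s s' : ℝ, 0 ≤ s → s ≤ s' → s' ≤ t →
      ∃ k : ℕ, (k : ℝ) * h ≤ s' - s + h ∧ s' - s - h ≤ (k : ℝ) * h ∧
      q ((F h ^ steps (t - s') h) (f s') - (F h ^ steps (t - s) h) (f s)) ≤
        Q ((F h ^ k) (f s) - f s') := by
    intro h hh s s' hs hss hst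
    obtain ⟨k, h1, h2, h3⟩ := pow_steps_eq F hh hss hst
    refine ⟨k, h1, h2, ?_⟩
    rw [h3, mul_apply_eq_comp, ← map_sub, ← map_sub_rev Q]
    exact hQ _ _ ((steps_mul_le (by linarith) h).trans (by linarith)) _
  have key := eventually_seminorm_sub_le_of_deriv_zero (L := 𝓝[>] (0 : ℝ≥0))
    (fun s h => (F h ^ steps (t - s) h) (f s)) q ht ?_ ?_ (half_pos hε₀)
  · filter_upwards [key] with h hh
    simp only [sub_self, steps_zero, pow_zero, one_apply_eq_self, sub_zero] at hh
    rw [map_sub_rev]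
    linarith
  · intro s hs ε hε
    obtain ⟨g, -, hg⟩ := hf s ⟨hs.1, hs.2.trans_lt htl⟩
    have hfc : ContinuousWithinAt f (Set.Icc 0 t) s := by
      refine ContinuousWithinAt.mono (t := Set.Ico 0 l) ?_ (Set.Icc_subset_Ico_right htl)
      rw [← continuousWithinAt_sdiff_self]
      have h1 : Tendsto (fun u : ℝ => ((u - s : ℝ) : 𝕜)) (𝓝[Set.Ico 0 l \ {s}] s) (𝓝 0) := by
        have : Continuous fun u : ℝ => ((u - s : ℝ) : 𝕜) := by fun_prop
        simpa using (this.tendsto s).mono_left nhdsWithin_le_nhds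
      have h2 := (h1.smul hg).add_const (f s)
      rw [zero_smul, zero_add] at h2
      refine h2.congr' ?_
      filter_upwards [self_mem_nhdsWithin] with u hu
      have : ((u - s : ℝ) : 𝕜) ≠ 0 := by
        exact_mod_cast sub_ne_zero.2 hu.2
      rw [smul_inv_smul₀ this, sub_add_cancel]
    obtain ⟨δ, hδ, hK⟩ := exists_eventually_seminorm_pow_sub_le hF0 hF hd (f s) hQc (half_pos hε)
    have hnear : ∀ᶠ s' in 𝓝[Set.Icc 0 t] s, |s' - s| < δ / 2 := by
      refine nhdsWithin_le_nhds ?_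
      have : Tendsto (fun s' => |s' - s|) (𝓝 s) (𝓝 |s - s|) :=
        ((continuous_id.sub continuous_const).abs).tendsto s
      exact this.eventually_lt_const (by simpa using hδ)
    filter_upwards [eventually_seminorm_sub_lt hfc hQc (half_pos hε),
      eventually_seminorm_sub_lt hfc hQc' (half_pos hε), hnear, self_mem_nhdsWithin]
      with s' h1 h2 h3 hs'
    obtain ⟨h3, h3'⟩ := abs_lt.1 h3
    filter_upwards [hK, eventually_coe_lt (half_pos hδ), eventually_coe_lt one_pos,
      self_mem_nhdsWithin] with h h4 h5 h6 hh
    rcases le_total s s' with hss | hss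
    · obtain ⟨k, hk1, -, hk2⟩ := hstep h hh s s' hs.1 hss hs'.2
      refine hk2.trans ?_
      have h7 := h4 k (by linarith)
      have h8 := map_sub_le_add Q ((F h ^ k) (f s) - f s) (f s' - f s)
      rw [sub_sub_sub_cancel_right] at h8
      linarith
    · obtain ⟨k, hk1, -, hk2⟩ := hstep h hh s' s hs'.1 hss hs.2
      rw [map_sub_rev]
      refine hk2.trans ?_
      have h7 := h4 k (by linarith)
      have h8 := hQ' h k (by linarith [hs.2, hs'.1]) (f s' - f s)
      have h9 := map_add_le_add Q ((F h ^ k) (f s' - f s)) ((F h ^ k) (f s) - f s)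
      rw [map_sub (F h ^ k), sub_add_sub_cancel, ← map_sub (F h ^ k)] at h9
      linarith
  · intro s hs ε hε
    have hsl : s < l := hs.2.trans htl
    obtain ⟨g, hfg, hg⟩ := hf s ⟨hs.1, hsl⟩
    obtain ⟨δ, hδ, hK⟩ := exists_eventually_seminorm_taylor_le hF0 hF hd hfg hQc (half_pos hε)
    have hle : 𝓝[>] s ≤ 𝓝[Set.Ico 0 l \ {s}] s := by
      refine nhdsWithin_le_of_mem ?_
      filter_upwards [Ioo_mem_nhdsGT hsl] with u hu
      exact ⟨⟨hs.1.trans hu.1.le, hu.2⟩, hu.1.ne'⟩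
    have hδ' : s < min t (s + δ / 2) := lt_min hs.2 (by linarith)
    filter_upwards [eventually_seminorm_sub_lt (hg.mono_left hle) hQc (half_pos hε),
      Ioo_mem_nhdsGT hδ'] with s' h1 h2 η hη
    obtain ⟨h2, h3⟩ := h2
    obtain ⟨h3, h3'⟩ := lt_min_iff.1 h3
    have hQg : 0 ≤ Q g := apply_nonneg _ _
    have hc : 0 < η / 2 / (Q g + ε) := by positivity
    filter_upwards [hK (η / 2) (half_pos hη), eventually_coe_lt (half_pos hδ),
      eventually_coe_lt hc, self_mem_nhdsWithin] with h h4 h5 h6 hh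
    obtain ⟨k, hk1, hk1', hk2⟩ := hstep h hh s s' hs.1 h2.le h3.le
    refine hk2.trans ?_
    have hpos : 0 < s' - s := sub_pos.2 h2
    have hne : ((s' - s : ℝ) : 𝕜) ≠ 0 := by exact_mod_cast hpos.ne'
    -- Errors: the expansion of `F(h)^k f(s)`, the rounding of `k h`, the differentiability of `f`.
    have e : (F h ^ k) (f s) - f s' = ((F h ^ k) (f s) - f s - ((k * h : ℝ) : 𝕜) • g)
        + ((k * h - (s' - s) : ℝ) : 𝕜) • g
        - ((s' - s : ℝ) : 𝕜) • ((((s' - s : ℝ) : 𝕜))⁻¹ • (f s' - f s) - g) := by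
      rw [smul_sub, smul_inv_smul₀ hne]
      push_cast
      module
    have h7 := h4 k (by linarith)
    have h8 : Q (((k * h - (s' - s) : ℝ) : 𝕜) • g) ≤ h * Q g := by
      rw [map_smul_eq_mul, RCLike.norm_ofReal]
      gcongr
      exact abs_le.2 ⟨by linarith, by linarith⟩
    have h9 : Q (((s' - s : ℝ) : 𝕜) • ((((s' - s : ℝ) : 𝕜))⁻¹ • (f s' - f s) - g)) ≤
        (s' - s) * (ε / 2) := by
      rw [map_smul_eq_mul, RCLike.norm_ofReal, abs_of_pos hpos]
      gcongr
    have h10 : (h : ℝ) * (Q g + ε) < η / 2 := (lt_div_iff₀ (by positivity)).1 h6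
    have h11 : ε / 2 * (k * h) ≤ ε / 2 * (s' - s + h) := by gcongr
    have h12 : 0 ≤ (h : ℝ) * ε := by positivity
    rw [e]
    refine (map_sub_le_add Q _ _).trans ?_
    have h13 := map_add_le_add Q ((F h ^ k) (f s) - f s - ((k * h : ℝ) : 𝕜) • g)
      (((k * h - (s' - s) : ℝ) : 𝕜) • g)
    linarith

end Solutions

section Semigroup

theorem tendsto_steps_mul {t : ℝ} (ht : 0 ≤ t) :
    Tendsto (fun h : ℝ≥0 => (steps t h : ℝ) * h) (𝓝[>] 0) (𝓝 t) := by
  have h1 : Tendsto (fun h : ℝ≥0 => t - (h : ℝ)) (𝓝[>] 0) (𝓝 t) := by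
    have : Tendsto (fun h : ℝ≥0 => t - (h : ℝ)) (𝓝 0) (𝓝 (t - ((0 : ℝ≥0) : ℝ))) :=
      (continuous_const.sub NNReal.continuous_coe).tendsto 0
    simpa using this.mono_left nhdsWithin_le_nhds
  refine tendsto_of_tendsto_of_tendsto_of_le_of_le' h1 tendsto_const_nhds ?_ ?_
  · filter_upwards [self_mem_nhdsWithin] with h hh
    linarith [lt_steps_mul t hh]
  · exact Eventually.of_forall fun h => steps_mul_le ht h

theorem tendsto_div_natCast {t : ℝ≥0} (ht : 0 < t) :
    Tendsto (fun n : ℕ => t / (n : ℝ≥0)) atTop (𝓝[>] 0) := by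
  refine tendsto_nhdsWithin_iff.2 ⟨?_, ?_⟩
  · rw [← NNReal.tendsto_coe]
    push_cast
    exact tendsto_const_div_atTop_nhds_zero_nat (t : ℝ)
  · filter_upwards [eventually_gt_atTop 0] with n hn
    exact div_pos ht (by exact_mod_cast hn)

variable {𝕜 X Ω : Type*} [RCLike 𝕜] [AddCommGroup X] [Module 𝕜 X]

variable [TopologicalSpace X] [IsTopologicalAddGroup X] [ContinuousSMul 𝕜 X]

/-! ### Existence of the limit for all times -/

theorem exists_tendsto_of_approx {X : Type*} [AddCommGroup X] [Module 𝕜 X] [UniformSpace X]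
    [IsUniformAddGroup X] [CompleteSpace X] {p : SeminormFamily 𝕜 X Ω}
    (hp : WithSeminorms p) {ι : Type*} {L : Filter ι} [L.NeBot] {u : ι → X}
    (h : ∀ q : Seminorm 𝕜 X, Continuous q → ∀ ε > 0, ∃ y, ∀ᶠ i in L, q (u i - y) < ε) :
    ∃ y, Tendsto u L (𝓝 y) := by
  refine CompleteSpace.complete (f := L.map u) (cauchy_map_iff'.2 ?_)
  rw [uniformity_eq_comap_nhds_zero, tendsto_comap_iff]
  refine (hp.tendsto_nhds _ _).2 fun i ε hε => ?_
  obtain ⟨y, hy⟩ := h (p i) (hp.continuous_seminorm i) (ε / 2) (half_pos hε)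
  filter_upwards [hy.prod_mk hy] with z hz
  have h1 := map_sub_le_add (p i) (u z.2 - y) (u z.1 - y)
  rw [sub_sub_sub_cancel_right] at h1
  rw [sub_zero]
  exact h1.trans_lt (by linarith [hz.1, hz.2])

theorem exists_tendsto_pow_steps_of_dense {X : Type*} [AddCommGroup X] [Module 𝕜 X]
    [UniformSpace X] [IsUniformAddGroup X] [CompleteSpace X] [ContinuousSMul 𝕜 X]
    {p : SeminormFamily 𝕜 X Ω} (hp : WithSeminorms p) {F : ℝ≥0 → X →L[𝕜] X}
    (hF : LocallyEquicontinuous F) {D : Set X} (hD : Dense D) {t : ℝ} (ht : 0 ≤ t)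
    (h : ∀ g ∈ D, ∃ y, Tendsto (fun h : ℝ≥0 => (F h ^ steps t h) g) (𝓝[>] 0) (𝓝 y)) (g : X) :
    ∃ y, Tendsto (fun h : ℝ≥0 => (F h ^ steps t h) g) (𝓝[>] 0) (𝓝 y) := by
  refine exists_tendsto_of_approx hp fun q hq ε hε => ?_
  obtain ⟨Q, hQc, hQ⟩ := hF q hq t
  obtain ⟨f, hf, hfg⟩ := exists_mem_seminorm_lt_of_dense hD g hQc (half_pos hε)
  obtain ⟨y, hy⟩ := h f hf
  refine ⟨y, ?_⟩
  filter_upwards [eventually_seminorm_sub_lt hy hq (half_pos hε)] with h h1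
  have h2 := hQ h _ (steps_mul_le ht h) (g - f)
  have h3 := map_add_le_add q ((F h ^ steps t h) (g - f)) ((F h ^ steps t h) f - y)
  rw [map_sub (F h ^ steps t h), sub_add_sub_cancel, ← map_sub (F h ^ steps t h)] at h3
  linarith

/-- If `F(h)^⌊b / h⌋ x → y` and `F(h)^⌊a / h⌋ y → z`, then `F(h)^⌊(a + b) / h⌋ x → z`: the number of
steps differs from `⌊a / h⌋ + ⌊b / h⌋` by at most one, which strong continuity at `0` absorbs. -/
theorem tendsto_pow_steps_add {p : SeminormFamily 𝕜 X Ω}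
    (hp : WithSeminorms p) {F : ℝ≥0 → X →L[𝕜] X}
    (hF0 : F 0 = ContinuousLinearMap.id 𝕜 X) (hF : LocallyEquicontinuous F)
    (hd : Dense (mefDomain F)) {a b : ℝ} (ha : 0 ≤ a) (hb : 0 ≤ b) {x y z : X}
    (hb' : Tendsto (fun h : ℝ≥0 => (F h ^ steps b h) x) (𝓝[>] 0) (𝓝 y))
    (ha' : Tendsto (fun h : ℝ≥0 => (F h ^ steps a h) y) (𝓝[>] 0) (𝓝 z)) :
    Tendsto (fun h : ℝ≥0 => (F h ^ steps (a + b) h) x) (𝓝[>] 0) (𝓝 z) := by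
  refine (hp.tendsto_nhds _ _).2 fun i ε hε => ?_
  have hq := hp.continuous_seminorm i
  set q := p i
  obtain ⟨Q, hQc, hQ⟩ := hF q hq (a + b + 1)
  obtain ⟨δ, hδ, h1⟩ := exists_eventually_seminorm_pow_sub_le hF0 hF hd z hq
    (ε := ε / 4) (by positivity)
  filter_upwards [h1, eventually_seminorm_sub_lt hb' hQc (ε := ε / 4) (by positivity),
    eventually_seminorm_sub_lt ha' hQc (ε := ε / 4) (by positivity),
    eventually_coe_lt (half_pos hδ), eventually_coe_lt (δ := 1 / 2) (by norm_num),
    self_mem_nhdsWithin] with h h1 h2 h3 h4 h5 hh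
  obtain ⟨r, hr⟩ := Nat.exists_eq_add_of_le (steps_add_le ha hb h)
  have hab := steps_mul_le (add_nonneg ha hb) h
  have hsa := lt_steps_mul a hh
  have hsb := lt_steps_mul b hh
  have hsa0 := steps_mul_le ha h
  have hsb0 : 0 ≤ (steps b h : ℝ) * h := by positivity
  -- Each of the two roundings loses less than one step.
  have hrh : (r : ℝ) * h ≤ h + h := by
    rw [hr] at hab
    push_cast at hab
    linarith
  have e : (F h ^ steps (a + b) h) x - z =
      (F h ^ (r + steps a h)) ((F h ^ steps b h) x - y)
        + (F h ^ r) ((F h ^ steps a h) y - z) + ((F h ^ r) z - z) := by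
    rw [hr, show steps a h + steps b h + r = r + steps a h + steps b h by ring]
    simp only [map_sub, pow_add, mul_apply_eq_comp]
    abel
  have h6 := hQ h (r + steps a h) (by push_cast; linarith) ((F h ^ steps b h) x - y)
  have h7 := hQ h r (by linarith) ((F h ^ steps a h) y - z)
  have h8 := h1 r (by linarith)
  rw [e]
  refine (map_add_le_add q _ _).trans_lt ?_
  have h9 := map_add_le_add q ((F h ^ (r + steps a h)) ((F h ^ steps b h) x - y))
    ((F h ^ r) ((F h ^ steps a h) y - z))
  linarith

theorem exists_tendsto_pow_steps {p : SeminormFamily 𝕜 X Ω}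
    (hp : WithSeminorms p) {F : ℝ≥0 → X →L[𝕜] X}
    (hF0 : F 0 = ContinuousLinearMap.id 𝕜 X) (hF : LocallyEquicontinuous F)
    (hd : Dense (mefDomain F)) {l : ℝ} (hl : 0 < l)
    (h : ∀ t : ℝ, 0 ≤ t → t < l → ∀ g, ∃ y,
      Tendsto (fun h : ℝ≥0 => (F h ^ steps t h) g) (𝓝[>] 0) (𝓝 y))
    {t : ℝ} (ht : 0 ≤ t) (g : X) :
    ∃ y, Tendsto (fun h : ℝ≥0 => (F h ^ steps t h) g) (𝓝[>] 0) (𝓝 y) := by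
  obtain ⟨n, hn⟩ := exists_nat_ge (t / (l / 2))
  replace hn : t ≤ n * (l / 2) := (div_le_iff₀ (half_pos hl)).1 hn
  induction n generalizing t g with
  | zero => exact h t ht (by simp at hn; linarith) g
  | succ n ih =>
    rcases lt_or_ge t l with htl | htl
    · exact h t ht htl g
    · obtain ⟨y, hy⟩ := h (l / 2) (half_pos hl).le (half_lt_self hl) g
      obtain ⟨z, hz⟩ := ih (t := t - l / 2) (by linarith) y (by push_cast at hn; linarith)
      refine ⟨z, ?_⟩
      have := tendsto_pow_steps_add hp hF0 hF hd (by linarith) (half_pos hl).le hy hz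
      simpa using this

theorem exists_limit_operators [T2Space X] {p : SeminormFamily 𝕜 X Ω}
    (hp : WithSeminorms p) {F : ℝ≥0 → X →L[𝕜] X} (hF : LocallyEquicontinuous F)
    (h : ∀ (t : ℝ≥0) (g : X), ∃ y, Tendsto (fun h : ℝ≥0 => (F h ^ steps t h) g) (𝓝[>] 0) (𝓝 y)) :
    ∃ S : ℝ≥0 → X →L[𝕜] X, ∀ (t : ℝ≥0) (g : X),
      Tendsto (fun h : ℝ≥0 => (F h ^ steps t h) g) (𝓝[>] 0) (𝓝 (S t g)) := by
  choose S hS using h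
  refine ⟨fun t => ⟨⟨⟨S t, fun x y => ?_⟩, fun c x => ?_⟩, ?_⟩, hS⟩
  · refine tendsto_nhds_unique (hS t (x + y)) ?_
    simpa using (hS t x).add (hS t y)
  · refine tendsto_nhds_unique (hS t (c • x)) ?_
    simpa using (hS t x).const_smul c
  · refine continuous_iff_continuousAt.2 fun x => (hp.tendsto_nhds _ _).2 fun i ε hε => ?_
    have hq := hp.continuous_seminorm i
    obtain ⟨Q, hQc, hQ⟩ := hF (p i) hq t
    filter_upwards [eventually_seminorm_sub_lt (continuous_id.tendsto x) hQc hε] with y hy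
    refine lt_of_le_of_lt (le_of_tendsto ((hq.tendsto _).comp ((hS t y).sub (hS t x)))
      (Eventually.of_forall fun h => ?_)) hy
    rw [Function.comp_apply, ← map_sub]
    exact hQ h _ (steps_mul_le t.2 h) (y - x)

/-! ### The limit semigroup -/

theorem seminorm_limit_sub_le {F S : ℝ≥0 → X →L[𝕜] X}
    (hF0 : F 0 = ContinuousLinearMap.id 𝕜 X) (hF : LocallyEquicontinuous F)
    (hd : Dense (mefDomain F))
    (hS : ∀ (t : ℝ≥0) (g : X), Tendsto (fun h : ℝ≥0 => (F h ^ steps t h) g) (𝓝[>] 0) (𝓝 (S t g)))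
    (x : X) {q : Seminorm 𝕜 X} (hq : Continuous q) {ε : ℝ} (hε : 0 < ε) :
    ∃ δ : ℝ, 0 < δ ∧ ∀ t : ℝ≥0, (t : ℝ) ≤ δ → q (S t x - x) ≤ ε := by
  obtain ⟨δ, hδ, h⟩ := exists_eventually_seminorm_pow_sub_le hF0 hF hd x hq hε
  refine ⟨δ, hδ, fun t ht => le_of_tendsto
    ((hq.tendsto _).comp ((hS t x).sub tendsto_const_nhds)) ?_⟩
  filter_upwards [h] with h hh
  exact hh _ ((steps_mul_le t.2 h).trans ht)

theorem seminorm_limit_taylor_le {F S : ℝ≥0 → X →L[𝕜] X}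
    (hF0 : F 0 = ContinuousLinearMap.id 𝕜 X) (hF : LocallyEquicontinuous F)
    (hd : Dense (mefDomain F))
    (hS : ∀ (t : ℝ≥0) (g : X), Tendsto (fun h : ℝ≥0 => (F h ^ steps t h) g) (𝓝[>] 0) (𝓝 (S t g)))
    {f g : X} (hfg : (f, g) ∈ closure (mefGraph F : Set (X × X)))
    {q : Seminorm 𝕜 X} (hq : Continuous q) {ε : ℝ} (hε : 0 < ε) :
    ∃ δ : ℝ, 0 < δ ∧ ∀ t : ℝ≥0, (t : ℝ) ≤ δ →
      q (S t f - f - ((t : ℝ) : 𝕜) • g) ≤ ε * t := by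
  obtain ⟨δ, hδ, h⟩ := exists_eventually_seminorm_taylor_le hF0 hF hd hfg hq hε
  refine ⟨δ, hδ, fun t ht => le_of_forall_pos_le_add fun η hη => ?_⟩
  have h1 := tendsto_steps_mul t.2
  have h2 : Tendsto (fun h : ℝ≥0 => ((steps t h * h : ℝ) : 𝕜)) (𝓝[>] 0) (𝓝 ((t : ℝ) : 𝕜)) :=
    (RCLike.continuous_ofReal.tendsto _).comp h1
  refine le_of_tendsto_of_tendsto
    ((hq.tendsto _).comp (((hS t f).sub tendsto_const_nhds).sub (h2.smul_const g)))
    ((h1.const_mul ε).add_const η) ?_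
  filter_upwards [h η hη] with h hh
  exact hh _ ((steps_mul_le t.2 h).trans ht)

theorem tendsto_diffQuot_limit {p : SeminormFamily 𝕜 X Ω}
    (hp : WithSeminorms p) {F S : ℝ≥0 → X →L[𝕜] X}
    (hF0 : F 0 = ContinuousLinearMap.id 𝕜 X) (hF : LocallyEquicontinuous F)
    (hd : Dense (mefDomain F))
    (hS : ∀ (t : ℝ≥0) (g : X), Tendsto (fun h : ℝ≥0 => (F h ^ steps t h) g) (𝓝[>] 0) (𝓝 (S t g)))
    (hS0 : S 0 = ContinuousLinearMap.id 𝕜 X)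
    {f g : X} (hfg : (f, g) ∈ closure (mefGraph F : Set (X × X))) :
    Tendsto (fun h : ℝ≥0 => (((h : ℝ) : 𝕜))⁻¹ • (S h f - S 0 f)) (𝓝[>] 0) (𝓝 g) := by
  refine (hp.tendsto_nhds _ _).2 fun i ε hε => ?_
  obtain ⟨δ, hδ, h1⟩ := seminorm_limit_taylor_le hF0 hF hd hS hfg (hp.continuous_seminorm i)
    (half_pos hε)
  filter_upwards [eventually_coe_lt hδ, self_mem_nhdsWithin] with t ht ht0
  have hpos : (0 : ℝ) < t := NNReal.coe_pos.2 ht0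
  have hne : ((t : ℝ) : 𝕜) ≠ 0 := by exact_mod_cast hpos.ne'
  have e : (((t : ℝ) : 𝕜))⁻¹ • (S t f - S 0 f) - g =
      (((t : ℝ) : 𝕜))⁻¹ • (S t f - f - ((t : ℝ) : 𝕜) • g) := by
    rw [smul_sub _ _ (((t : ℝ) : 𝕜) • g), inv_smul_smul₀ hne, hS0]
    rfl
  rw [e, map_smul_eq_mul, norm_inv, RCLike.norm_ofReal, abs_of_pos hpos]
  calc (t : ℝ)⁻¹ * p i (S t f - f - ((t : ℝ) : 𝕜) • g) ≤ (t : ℝ)⁻¹ * (ε / 2 * t) := by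
        gcongr
        exact h1 t ht.le
    _ = ε / 2 := by field_simp
    _ < ε := half_lt_self hε

theorem isLC0Semigroup_limit [T2Space X] {p : SeminormFamily 𝕜 X Ω}
    (hp : WithSeminorms p) {F S : ℝ≥0 → X →L[𝕜] X} (hF : ClassF p F)
    (hS : ∀ (t : ℝ≥0) (g : X), Tendsto (fun h : ℝ≥0 => (F h ^ steps t h) g) (𝓝[>] 0) (𝓝 (S t g))) :
    IsLC0Semigroup p S := by
  have hF0 := hF.classE.map_zero
  have hFe := hF.classE.locallyEquicontinuous hp
  have hS0 : S 0 = ContinuousLinearMap.id 𝕜 X := by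
    ext x
    refine tendsto_nhds_unique (hS 0 x) ?_
    simp [steps_zero]
  have hadd : ∀ a b, S (a + b) = (S a).comp (S b) := by
    intro a b
    ext x
    refine tendsto_nhds_unique (hS (a + b) x) ?_
    exact (tendsto_pow_steps_add hp hF0 hFe hF.dense a.2 b.2 (hS b x) (hS a _) :)
  refine ⟨hS0, hadd, fun x => continuous_iff_continuousAt.2 fun t =>
    (hp.tendsto_nhds _ _).2 fun i ε hε => ?_, hS0, fun s α => ?_⟩
  · have hq := hp.continuous_seminorm i
    obtain ⟨Q, hQc, hQ⟩ := hFe (p i) hq (t + 1)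
    have hSQ : ∀ (r : ℝ≥0), (r : ℝ) ≤ t + 1 → ∀ x, p i (S r x) ≤ Q x := fun r hr x =>
      le_of_tendsto ((hq.tendsto _).comp (hS r x)) (Eventually.of_forall fun h =>
        hQ h _ ((steps_mul_le r.2 h).trans hr) x)
    obtain ⟨δ, hδ, h1⟩ := seminorm_limit_sub_le hF0 hFe hF.dense hS x hQc (half_pos hε)
    have hnear : ∀ᶠ r : ℝ≥0 in 𝓝 t, |(r : ℝ) - t| < min δ 1 := by
      have : Tendsto (fun r : ℝ≥0 => |(r : ℝ) - t|) (𝓝 t) (𝓝 |(t : ℝ) - t|) :=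
        ((NNReal.continuous_coe.sub continuous_const).abs).tendsto t
      exact this.eventually_lt_const (by simpa using hδ)
    filter_upwards [hnear] with r hr
    obtain ⟨hr1, hr2⟩ := lt_min_iff.1 hr
    obtain ⟨hr1, hr1'⟩ := abs_lt.1 hr1
    obtain ⟨hr2, hr2'⟩ := abs_lt.1 hr2
    rcases le_total t r with htr | htr
    · obtain ⟨a, rfl⟩ := exists_add_of_le htr
      push_cast at hr1'
      rw [hadd, ContinuousLinearMap.comp_apply, ← map_sub]
      have h2 := hSQ t (by linarith) (S a x - x)
      have h3 := h1 a (by linarith)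
      linarith
    · obtain ⟨a, rfl⟩ := exists_add_of_le htr
      push_cast at hr1 hr2' hSQ
      rw [hadd, ContinuousLinearMap.comp_apply, ← map_sub]
      have h2 := hSQ r (by linarith [a.2]) (x - S a x)
      rw [map_sub_rev Q] at h2
      have h3 := h1 a (by linarith)
      linarith
  · obtain ⟨I, b, hb, h⟩ := hF.classE.equicontinuous s α
    refine ⟨I, b, hb, ?_⟩
    rintro G ⟨n, m, d, -, -, hs, rfl⟩ x
    rw [pow_eq_of_map_add hS0 hadd]
    refine le_of_tendsto (((hp.continuous_seminorm α).tendsto _).comp (hS _ x))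
      (Eventually.of_forall fun r => h _ (pow_mem_powerSet hF0 ?_) x)
    refine (steps_mul_le (NNReal.coe_nonneg _) r).trans (NNReal.coe_le_coe.2 ?_)
    rwa [← mul_div_assoc]

theorem tendsto_pow_div_natCast {𝕜 X : Type*} [RCLike 𝕜] [AddCommGroup X] [Module 𝕜 X]
    [TopologicalSpace X] [IsTopologicalAddGroup X] {F S : ℝ≥0 → X →L[𝕜] X}
    (hF0 : F 0 = ContinuousLinearMap.id 𝕜 X) (hS0 : S 0 = ContinuousLinearMap.id 𝕜 X)
    (hS : ∀ (t : ℝ≥0) (g : X), Tendsto (fun h : ℝ≥0 => (F h ^ steps t h) g) (𝓝[>] 0) (𝓝 (S t g)))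
    (t : ℝ≥0) (g : X) :
    Tendsto (fun n : ℕ => (F (t / (n : ℝ≥0)) ^ n) g) atTop (𝓝 (S t g)) := by
  rcases eq_or_ne t 0 with rfl | ht
  · have : (ContinuousLinearMap.id 𝕜 X) = 1 := rfl
    simpa [hF0, hS0, this] using tendsto_const_nhds
  · have ht0 := pos_iff_ne_zero.2 ht
    refine ((hS t g).comp (tendsto_div_natCast ht0)).congr' ?_
    filter_upwards [eventually_gt_atTop 0] with n hn
    simp only [Function.comp_apply]
    rw [steps_div_natCast ht0 hn.ne']

/-! ### The generator -/

/-- A core criterion. The vectors `n⁻¹ ∑_{j < n} S(τ)^j a` with `a ∈ D` and `n τ = δ` are Riemann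
sums for `δ⁻¹ ∫₀^δ S(s) a ds`, and the generator `A` of `S` maps them approximately to
`δ⁻¹ (S(δ) a - a)`. Hence a closed subspace `G` that contains the pairs `(S(s) a, S(s) A a)` for
`s < l` contains every pair `(x, A x)`; it is enough that `l > 0`, since `δ` may be small. -/
theorem mem_of_tendsto_diffQuot {p : SeminormFamily 𝕜 X Ω}
    (hp : WithSeminorms p) {S : ℝ≥0 → X →L[𝕜] X} (hS : IsLC0Semigroup p S)
    {G : Submodule 𝕜 (X × X)} (hG : IsClosed (G : Set (X × X))) {D : Set X} (hD : Dense D)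
    {l : ℝ} (hl : 0 < l)
    (hDG : ∀ a ∈ D, ∃ b, (∀ s : ℝ≥0, (s : ℝ) < l → (S s a, S s b) ∈ G) ∧
      Tendsto (fun h : ℝ≥0 => (((h : ℝ) : 𝕜))⁻¹ • (S h a - S 0 a)) (𝓝[>] 0) (𝓝 b))
    {x y : X}
    (hxy : Tendsto (fun h : ℝ≥0 => (((h : ℝ) : 𝕜))⁻¹ • (S h x - S 0 x)) (𝓝[>] 0) (𝓝 y)) :
    (x, y) ∈ G := by
  have hS0 := hS.map_zero
  have hpow := pow_eq_of_map_add hS0 hS.map_add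
  have key : (x, y) ∈ closure (G : Set (X × X)) := by
    refine mem_closure_of_forall_seminorm hp fun q hq ε hε => ?_
    obtain ⟨Q, hQc, hQ⟩ := hS.classE.locallyEquicontinuous hp q hq 1
    have hcont : ∀ᶠ s : ℝ≥0 in 𝓝 0, q (S s x - x) < ε / 2 := by
      have h1 := (hS.continuous x).tendsto 0
      rw [hS0] at h1
      exact eventually_seminorm_sub_lt h1 hq (half_pos hε)
    obtain ⟨δ₀, hδ₀, h1⟩ := Metric.eventually_nhds_iff.1 hcont
    obtain ⟨δ, h2, h3, h4, h5, hδ⟩ := ((eventually_seminorm_sub_lt hxy hq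
      (ε := ε / 4) (by positivity)).and ((eventually_coe_lt hδ₀).and ((eventually_coe_lt hl).and
      ((eventually_coe_lt one_pos).and self_mem_nhdsWithin)))).exists
    have hδpos : (0 : ℝ) < δ := NNReal.coe_pos.2 hδ
    have hδne : ((δ : ℝ) : 𝕜) ≠ 0 := by exact_mod_cast hδpos.ne'
    obtain ⟨a, haD, ha⟩ := exists_mem_seminorm_lt_of_dense hD x hQc (ε := δ * (ε / 4))
      (by positivity)
    obtain ⟨b, hbG, hb⟩ := hDG a haD
    obtain ⟨n, h6, hn⟩ := (((tendsto_div_natCast hδ).eventually (eventually_seminorm_sub_lt hb hQc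
      (ε := ε / 4) (by positivity))).and (eventually_gt_atTop 0)).exists
    set τ : ℝ≥0 := δ / (n : ℝ≥0) with hτdef
    have hn0 : (n : ℝ≥0) ≠ 0 := by exact_mod_cast hn.ne'
    have hτpos : 0 < τ := div_pos hδ (pos_iff_ne_zero.2 hn0)
    have hnτ' : (n : ℝ≥0) * τ = δ := by rw [hτdef, mul_div_cancel₀ _ hn0]
    have hnτ : (n : ℝ) * τ = δ := by exact_mod_cast congrArg NNReal.toReal hnτ'
    have hjτ : ∀ j < n, (j : ℝ) * τ ≤ δ := fun j hj => cast_mul_le_of_le hj.le hnτ.le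
    have hmem : (((δ : ℝ) : 𝕜))⁻¹ • ((τ : ℝ) : 𝕜) • ∑ j ∈ Finset.range n, ((S τ ^ j) a, (S τ ^ j) b)
        ∈ G := by
      refine G.smul_mem _ (G.smul_mem _ (G.sum_mem fun j hj => ?_))
      rw [hpow]
      refine hbG _ (lt_of_le_of_lt ?_ h4)
      push_cast
      exact hjτ j (Finset.mem_range.1 hj)
    refine ⟨_, hmem, ?_, ?_⟩
    · have e : (((δ : ℝ) : 𝕜))⁻¹ • ((τ : ℝ) : 𝕜) • ∑ j ∈ Finset.range n, (S τ ^ j) a - x =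
          (((δ : ℝ) : 𝕜))⁻¹ • ((τ : ℝ) : 𝕜) • ∑ j ∈ Finset.range n, ((S τ ^ j) a - x) := by
        have : ((δ : ℝ) : 𝕜) = ((τ : ℝ) : 𝕜) * (n : 𝕜) := by
          rw [← hnτ]
          push_cast
          ring
        rw [Finset.sum_sub_distrib, Finset.sum_const, Finset.card_range, smul_sub, smul_sub,
          ← Nat.cast_smul_eq_nsmul 𝕜, smul_smul _ _ x, ← this, inv_smul_smul₀ hδne]
      simp only [Prod.smul_fst, Prod.fst_sum]
      rw [e, map_smul_eq_mul, norm_inv, RCLike.norm_ofReal, abs_of_pos hδpos,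
        inv_mul_le_iff₀ hδpos]
      refine (seminorm_smul_sum_le q τ n _ ε fun j hj => ?_).trans_eq (by rw [hnτ])
      have h7 := hQ τ j ((hjτ j hj).trans h5.le) (a - x)
      have h8 : q ((S τ ^ j) x - x) < ε / 2 := by
        rw [hpow]
        refine h1 ?_
        rw [NNReal.dist_eq]
        push_cast
        rw [sub_zero, abs_of_nonneg (by positivity)]
        exact (hjτ j hj).trans_lt h3
      have h9 := map_add_le_add q ((S τ ^ j) (a - x)) ((S τ ^ j) x - x)
      rw [map_sub (S τ ^ j), sub_add_sub_cancel, ← map_sub (S τ ^ j)] at h9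
      rw [map_sub_rev] at ha
      have : δ * (ε / 4) ≤ 1 * (ε / 4) := by gcongr
      linarith
    · simp only [Prod.smul_snd, Prod.snd_sum]
      have hQ' : ∀ (h : ℝ≥0) (k : ℕ), (k : ℝ) * h ≤ δ → ∀ x : X, q ((S h ^ k) x) ≤ Q x :=
        fun h k hk => hQ h k (hk.trans h5.le)
      set w := (((τ : ℝ) : 𝕜))⁻¹ • (S τ a - S 0 a)
      have hw : defect S τ n a w = 0 := defect_eq_zero hS0 hτpos n a
      have h7 := seminorm_defect_le hδpos.le hQ' hnτ.le (a - a) (w - b)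
      rw [← defect_sub, hw, sub_self, map_zero, mul_zero, zero_add, zero_sub,
        map_neg_eq_map] at h7
      have h8 := seminorm_defect_le hδpos.le hQ' hnτ.le (a - x) (0 - 0)
      rw [← defect_sub, sub_self, map_zero, mul_zero, add_zero, ← map_sub_rev Q x] at h8
      have e : (((δ : ℝ) : 𝕜))⁻¹ • ((τ : ℝ) : 𝕜) • ∑ j ∈ Finset.range n, (S τ ^ j) b - y =
          (((δ : ℝ) : 𝕜))⁻¹ • (defect S τ n a 0 - defect S τ n x 0 - defect S τ n a b)
          + ((((δ : ℝ) : 𝕜))⁻¹ • (S δ x - S 0 x) - y) := by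
        have h9 : (S τ ^ n) x = S δ x := by rw [hpow, hnτ']
        have h10 : S 0 x = x := by rw [hS0]; rfl
        simp only [defect, map_zero, Finset.sum_const_zero, smul_zero, sub_zero, h9, h10]
        rw [← add_sub_assoc, ← smul_add]
        congr 2
        abel
      have h9 := map_sub_le_add q (defect S τ n a 0 - defect S τ n x 0) (defect S τ n a b)
      have h10 : q (defect S τ n a 0 - defect S τ n x 0 - defect S τ n a b) ≤ δ * (ε * (3 / 4)) := by
        have : δ * Q (w - b) ≤ δ * (ε / 4) := by gcongr
        linarith
      rw [e]
      refine (map_add_le_add q _ _).trans ?_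
      rw [map_smul_eq_mul, norm_inv, RCLike.norm_ofReal, abs_of_pos hδpos]
      have h11 := (inv_mul_le_iff₀ hδpos).2 h10
      linarith
  exact hG.closure_subset key

end Semigroup

end Chernoff

theorem theorem8p1 {𝕜 X Ω : Type*} [RCLike 𝕜] [AddCommGroup X] [Module 𝕜 X]
    [UniformSpace X] [IsUniformAddGroup X] [ContinuousSMul 𝕜 X] [T2Space X] [CompleteSpace X]
    (p : SeminormFamily 𝕜 X Ω) (hp : WithSeminorms p)
    (F : ℝ≥0 → X →L[𝕜] X) (hF : Chernoff.ClassF p F)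
    -- `D(Z) ⊆ D(F'_ef(0))` and `Z g = F'_ef(0) g` for `g ∈ D(Z)`
    (Z : X →ₗ.[𝕜] X) (hZ : Z ≤ Chernoff.effDeriv F)
    (𝔄 : Submodule 𝕜 X) (h𝔄Z : 𝔄 ≤ Z.domain) (h𝔄 : Dense (𝔄 : Set X))
    (l : ℝ) (hl : 0 < l)
    (hsol : ∀ f₀ ∈ 𝔄, ∃ f : ℝ → X, Chernoff.IsLocalSolution Z.closure l f₀ f) :
    Z.IsClosable ∧
    ∃ S : ℝ≥0 → X →L[𝕜] X, Chernoff.IsGenerator p Z.closure S ∧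
      ∀ (t : ℝ≥0) (g : X),
        Tendsto (fun n : ℕ => (F (t / (n : ℝ≥0)) ^ n) g) atTop (𝓝 (S t g)) := by
  open Chernoff in
  have hF0 := hF.classE.map_zero
  have hFe := hF.classE.locallyEquicontinuous hp
  have hd := hF.dense
  have hcl : Z.IsClosable := isClosable_of_le_effDeriv hp hF0 hFe hd hZ
  have hgraph := hcl.graph_closure_eq_closure_graph
  have hsub : ∀ z ∈ Z.closure.graph, z ∈ closure (mefGraph F : Set (X × X)) := by
    intro z hz
    rw [← hgraph] at hz
    exact closure_graph_subset hp hF0 hFe hd hZ hz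
  have hlim : ∀ f₀ ∈ 𝔄, ∀ t : ℝ, 0 ≤ t → t < l → ∃ y ∈ Z.closure.domain,
      Tendsto (fun h : ℝ≥0 => (F h ^ steps t h) f₀) (𝓝[>] 0) (𝓝 y) := by
    intro f₀ hf₀ t ht htl
    obtain ⟨f, rfl, hf⟩ := hsol f₀ hf₀
    refine ⟨f t, (hf t ⟨ht, htl⟩).1, tendsto_pow_steps_of_solution hp hF0 hFe hd ?_ ht htl⟩
    intro s hs
    obtain ⟨hs', h⟩ := hf s hs
    exact ⟨_, hsub _ (Z.closure.mem_graph ⟨f s, hs'⟩), h⟩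
  obtain ⟨S, hS⟩ := exists_limit_operators hp hFe fun t g =>
    exists_tendsto_pow_steps hp hF0 hFe hd hl (fun t ht htl =>
      exists_tendsto_pow_steps_of_dense hp hFe h𝔄 ht fun f₀ hf₀ =>
        let ⟨y, _, hy⟩ := hlim f₀ hf₀ t ht htl
        ⟨y, hy⟩) t.2 g
  have hsg : IsLC0Semigroup p S := isLC0Semigroup_limit hp hF hS
  have hgen : ∀ x y, (x, y) ∈ Z.closure.graph →
      Tendsto (fun h : ℝ≥0 => (((h : ℝ) : 𝕜))⁻¹ • (S h x - S 0 x)) (𝓝[>] 0) (𝓝 y) :=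
    fun x y hxy => tendsto_diffQuot_limit hp hF0 hFe hd hS hsg.map_zero (hsub _ hxy)
  refine ⟨hcl, S, ⟨hsg, fun x y => ⟨hgen x y, fun hxy => ?_⟩⟩,
    tendsto_pow_div_natCast hF0 hsg.map_zero hS⟩
  refine mem_of_tendsto_diffQuot hp hsg (hcl.closure_isClosed) h𝔄 hl (fun a ha => ?_) hxy
  have hab := Z.closure.mem_graph ⟨a, Z.le_closure.1 (h𝔄Z ha)⟩
  refine ⟨_, fun s hs => ?_, hgen _ _ hab⟩
  obtain ⟨y, hy, hlim⟩ := hlim a ha s s.2 hs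
  obtain rfl := tendsto_nhds_unique hlim (hS s a)
  have h1 := Z.closure.mem_graph ⟨S s a, hy⟩
  have h2 := ((S s).continuous.tendsto _).comp (hgen _ _ hab)
  -- `S(s)` commutes with difference quotients, so `Z` maps `S(s) a` to `S(s) Z a`.
  have h3 : Z.closure ⟨S s a, hy⟩ = S s (Z.closure ⟨a, Z.le_closure.1 (h𝔄Z ha)⟩) := by
    refine tendsto_nhds_unique (hgen _ _ h1) (h2.congr fun h => ?_)
    have hcomm : ∀ r, S r (S s a) = S s (S r a) := fun r => by
      rw [← ContinuousLinearMap.comp_apply, ← ContinuousLinearMap.comp_apply, ← hsg.map_add,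
        ← hsg.map_add, add_comm]
    simp [hcomm]
  rwa [h3] at h1
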